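/- Let $A$ be a finite (possibly nonabelian) group and let $A^{\mathbb N}$, $\mathbb N=\{0,1,2,\ldots\}$, carry the product $\sigma$-algebra. Let $\sigma:A^{\mathbb N}\to A^{\mathbb N}$ be the shift, $\sigma(a)_n=a_{n+1}$, and let $\Phi:A^{\mathbb N}\to A^{\mathbb N}$ be the nearest neighbour multiplication cellular automaton, $\Phi(a)_n=a_n\cdot a_{n+1}$. Put $$h_{\max}=\max\{\log_2|C| : C \text{ a proper subgroup of } A\}$$ (with $h_{\max}=0$ if $A$ is trivial, so that $h_{\max}=0$ whenever $A$ has no nontrivial proper subgroup). Let $\mu$ be a probability measure on $A^{\mathbb N}$ that is $\sigma$-invariant and $\Phi$-ergodic (that is, $\mu$ is $\Phi$-invariant and every measurable set $U$ with $\Phi^{-1}(U)=U$ has $\mu(U)\in\{0,1\}$). If $h(\mu,\sigma)>h_{\max}$, where $h(\mu,\sigma)$ is the Kolmogorov–Sinai entropy of the measure-preserving system $(A^{\mathbb N},\sigma,\mu)$ computed with logarithms to base $2$, then $\mu$ is the uniform Bernoulli measure on $A^{\mathbb N}$, under which the coordinates are independent and uniformly distributed on $A$. -/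

import Mathlib

open MeasureTheory ProbabilityTheory Filter

noncomputable section

namespace MultCA

/-- The shift map on one-sided sequences: `(σ a)_n = a_{n+1}`. -/
def shift {A : Type*} (a : ℕ → A) : ℕ → A := fun n => a (n + 1)

/-- The (unilateral) nearest neighbour multiplication cellular automaton:
`(Φ a)_n = a_n * a_{n+1}`. -/
def multCA {A : Type*} [Mul A] (a : ℕ → A) : ℕ → A := fun n => a n * a (n + 1)

/-- The uniform Bernoulli measure on `A^ℕ`: the coordinates are independent and uniformly
distributed on the finite set `A`. -/
def uniformMeasure (A : Type*) [MeasurableSpace A] : Measure (ℕ → A) :=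
  Measure.infinitePi fun _ : ℕ => uniformOn (Set.univ : Set A)

/-- A finite measurable partition of `X` into cells indexed by `Fin k` is encoded by the measurable
map `f : X → Fin k` that sends a point to the index of its cell (empty cells are harmless).
`blockEntropy T μ f n` is the Shannon entropy, in bits, of the join of
`f, f ∘ T, …, f ∘ T^(n-1)`. -/
def blockEntropy {X : Type*} [MeasurableSpace X] (T : X → X) (μ : Measure X) {k : ℕ}
    (f : X → Fin k) (n : ℕ) : ℝ :=
  -∑ w : Fin n → Fin k,
    μ.real {x | ∀ i : Fin n, f (T^[(i : ℕ)] x) = w i} *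
      Real.logb 2 (μ.real {x | ∀ i : Fin n, f (T^[(i : ℕ)] x) = w i})

/-- The entropy of `T` relative to the partition `f`: the limit of `blockEntropy T μ f n / n`. For a
measure-preserving `T` the limit exists, so the upper limit taken here is the limit. -/
def partitionEntropy {X : Type*} [MeasurableSpace X] (T : X → X) (μ : Measure X) {k : ℕ}
    (f : X → Fin k) : EReal :=
  limsup (fun n : ℕ => ((blockEntropy T μ f n / (n : ℝ) : ℝ) : EReal)) atTop

/-- The Kolmogorov–Sinai (measure-theoretic) entropy, in bits: the supremum, over all finite
measurable partitions, of the entropy of `T` relative to the partition. -/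
def entropy {X : Type*} [MeasurableSpace X] (T : X → X) (μ : Measure X) : EReal :=
  ⨆ (k : ℕ) (f : X → Fin k) (_ : Measurable f), partitionEntropy T μ f

/-- The largest value of `log₂ |C|` over the proper subgroups `C` of the finite group `A`
(it is `0` if there are none, that is, if `A` is trivial). -/
def hMax (A : Type*) [Group A] : ℝ :=
  sSup {r : ℝ | ∃ C : Subgroup A, C ≠ ⊤ ∧ r = Real.logb 2 (Nat.card C)}

end MultCA

end

/-! Write Φ for `multCA` and let `p x c` be the conditional law of the letter `a 0` given the tail
`shift a = c`. Since Φ commutes with the shift and `Φ(a)_0 = a_0 a_1`, invariance of μ says that the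
law at `multCA c` is a conditional average, given `multCA c`, of the law at `c` translated by `c 0`.
Summed over letters, the squared L² norms on both sides agree, so the averaging loses nothing and
the two laws coincide a.e. (`IsTailDensity.multCA_ae_eq`). Hence `p (g * a 0) (shift a)` is
Φ-invariant, so by ergodicity a constant η(g) (`IsTailDensity.exists_const`). The support of η is a
subgroup C, on which η is constant (`IsTailDensity.exists_subgroup`).

The tail thus determines the coset `C * a 0`: given the future, a letter carries at most log₂|C|
bits, which bounds the entropy (`entropy_shift_le`). The entropy hypothesis forces C = A. Then `a 0`
is uniform and independent of the tail, and shift-invariance yields the Bernoulli measure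
(`IsTailDensity.eq_uniformMeasure`). -/

namespace MultCA

/-! ### Shannon entropy of finitely valued random variables. -/

section Shannon

/-- Gibbs' inequality for finitely supported sub-probability vectors. -/
lemma sum_negMulLog_le_of_sum_le {S : Type*} [Fintype S] (p q : S → ℝ) (hp : ∀ s, 0 ≤ p s)
    (hq : ∀ s, 0 ≤ q s) (hpq : ∀ s, q s = 0 → p s = 0) (hsum : ∑ s, q s ≤ ∑ s, p s) :
    ∑ s, Real.negMulLog (p s) ≤ -∑ s, p s * Real.log (q s) := by
  have key : ∀ s, Real.negMulLog (p s) + p s * Real.log (q s) ≤ q s - p s := by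
    intro s
    rcases (hp s).eq_or_lt with h | h
    · simp [← h, hq s]
    · have hq' : 0 < q s := (hq s).lt_of_ne fun h0 => h.ne' (hpq s h0.symm)
      have h1 := Real.log_le_sub_one_of_pos (div_pos hq' h)
      rw [Real.log_div hq'.ne' h.ne'] at h1
      have h2 := mul_le_mul_of_nonneg_left h1 h.le
      have h3 : p s * (q s / p s - 1) = q s - p s := by field_simp
      rw [Real.negMulLog]
      nlinarith
  have := Finset.sum_le_sum fun s (_ : s ∈ Finset.univ) => key s
  rw [Finset.sum_add_distrib, Finset.sum_sub_distrib] at this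
  linarith

variable {Ω : Type*} [MeasurableSpace Ω] {S T : Type*} [Fintype S] [Fintype T]
  [MeasurableSpace S] [MeasurableSingletonClass S] [MeasurableSpace T] [MeasurableSingletonClass T]

/-- The Shannon entropy, in nats, of a random variable with finitely many values. -/
noncomputable def shannon (μ : Measure Ω) (X : Ω → S) : ℝ :=
  ∑ s, Real.negMulLog (μ.real (X ⁻¹' {s}))

omit [MeasurableSpace T] [MeasurableSingletonClass T] in
lemma sum_measureReal_fiber_mul (μ : Measure Ω) [IsFiniteMeasure μ] {X : Ω → S}
    (hX : Measurable X) (φ : S → T) (g : T → ℝ) :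
    ∑ s, μ.real (X ⁻¹' {s}) * g (φ s) = ∑ t, μ.real ((fun ω => φ (X ω)) ⁻¹' {t}) * g t := by
  classical
  rw [← Finset.sum_fiberwise Finset.univ φ]
  refine Finset.sum_congr rfl fun t _ => ?_
  have h : (fun ω => φ (X ω)) ⁻¹' {t} =
      X ⁻¹' (((Finset.univ.filter fun s => φ s = t) : Finset S) : Set S) := by
    ext ω; simp
  rw [h, ← sum_measureReal_preimage_singleton _ fun y _ => hX (measurableSet_singleton y),
    Finset.sum_mul]
  refine Finset.sum_congr rfl fun s hs => ?_
  rw [(Finset.mem_filter.1 hs).2]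

lemma sum_measureReal_fiber (μ : Measure Ω) [IsProbabilityMeasure μ] {X : Ω → S}
    (hX : Measurable X) : ∑ s, μ.real (X ⁻¹' {s}) = 1 := by
  rw [sum_measureReal_preimage_singleton _ fun y _ => hX (measurableSet_singleton y)]
  simp

omit [MeasurableSpace S] [MeasurableSingletonClass S] in
lemma shannon_congr_ae {μ : Measure Ω} {X Y : Ω → S} (h : X =ᵐ[μ] Y) :
    shannon μ X = shannon μ Y := by
  refine Finset.sum_congr rfl fun s _ => ?_
  congr 1
  refine measureReal_congr ?_
  filter_upwards [h] with ω hω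
  change (X ω = s) = (Y ω = s)
  rw [hω]

lemma shannon_comp_measurePreserving {μ : Measure Ω} {τ : Ω → Ω} (hτ : MeasurePreserving τ μ μ)
    {X : Ω → S} (hX : Measurable X) : shannon μ (fun ω => X (τ ω)) = shannon μ X := by
  refine Finset.sum_congr rfl fun s _ => ?_
  congr 1
  exact hτ.measureReal_preimage (hX (measurableSet_singleton s)).nullMeasurableSet

omit [MeasurableSpace T] [MeasurableSingletonClass T] in
lemma shannon_map_le (μ : Measure Ω) [IsProbabilityMeasure μ] {X : Ω → S} (hX : Measurable X)
    (φ : S → T) : shannon μ (fun ω => φ (X ω)) ≤ shannon μ X := by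
  have h := sum_measureReal_fiber_mul μ hX φ
    fun t => Real.log (μ.real ((fun ω => φ (X ω)) ⁻¹' {t}))
  have h1 : shannon μ (fun ω => φ (X ω)) = -∑ s, μ.real (X ⁻¹' {s}) *
      Real.log (μ.real ((fun ω => φ (X ω)) ⁻¹' {φ s})) := by
    rw [h, shannon, ← Finset.sum_neg_distrib]
    simp [Real.negMulLog]
  rw [h1, shannon, ← Finset.sum_neg_distrib]
  refine Finset.sum_le_sum fun s _ => ?_
  rw [Real.negMulLog, neg_mul, neg_le_neg_iff]
  rcases (measureReal_nonneg (μ := μ) (s := X ⁻¹' {s})).eq_or_lt with h0 | h0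
  · simp [← h0]
  · refine mul_le_mul_of_nonneg_left (Real.log_le_log h0 (measureReal_mono ?_)) h0.le
    intro ω hω
    simp only [Set.mem_preimage, Set.mem_singleton_iff] at hω ⊢
    rw [hω]

omit [MeasurableSpace T] [MeasurableSingletonClass T] in
/-- A random variable that is almost surely determined by another has smaller entropy. -/
lemma shannon_le_of_determined (μ : Measure Ω) [IsProbabilityMeasure μ] {X : Ω → T} {Y : Ω → S}
    (hY : Measurable Y) {G : Set Ω} (hG : ∀ᵐ ω ∂μ, ω ∈ G)
    (h : ∀ ω ∈ G, ∀ ω' ∈ G, Y ω = Y ω' → X ω = X ω') : shannon μ X ≤ shannon μ Y := by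
  classical
  obtain ⟨ω₀, -⟩ := hG.exists
  -- `X` factors through `Y` on `G`; the value `X ω₀` at letters not attained on `G` is arbitrary.
  let φ : S → T := fun s => if hs : ∃ ω ∈ G, Y ω = s then X hs.choose else X ω₀
  have : X =ᵐ[μ] fun ω => φ (Y ω) := by
    filter_upwards [hG] with ω hω
    have hs : ∃ ω' ∈ G, Y ω' = Y ω := ⟨ω, hω, rfl⟩
    simp only [φ, dif_pos hs]
    exact h _ hω _ hs.choose_spec.1 hs.choose_spec.2.symm
  rw [shannon_congr_ae this]
  exact shannon_map_le μ hY φ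

/-- Subadditivity: Gibbs' inequality against the product of the marginals. -/
lemma shannon_pi_le (μ : Measure Ω) [IsProbabilityMeasure μ] {ι : Type*} [Fintype ι]
    [DecidableEq ι] {X : ι → Ω → S} (hX : ∀ i, Measurable (X i)) :
    shannon μ (fun ω i => X i ω) ≤ ∑ i, shannon μ (X i) := by
  have hXm : Measurable fun ω i => X i ω := measurable_pi_lambda _ hX
  have hle : ∀ (w : ι → S) i,
      μ.real ((fun ω i => X i ω) ⁻¹' {w}) ≤ μ.real (X i ⁻¹' {w i}) := fun w i =>
    measureReal_mono fun ω hω => congrFun (Set.mem_singleton_iff.1 hω) i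
  refine (sum_negMulLog_le_of_sum_le _ (fun w => ∏ i, μ.real (X i ⁻¹' {w i}))
    (fun _ => measureReal_nonneg) (fun w => Finset.prod_nonneg fun _ _ => measureReal_nonneg)
    (fun w hw => ?_) ?_).trans_eq ?_
  · obtain ⟨i, -, hi⟩ := Finset.prod_eq_zero_iff.1 hw
    exact le_antisymm ((hle w i).trans_eq hi) measureReal_nonneg
  · rw [sum_measureReal_fiber μ hXm, ← Fintype.prod_sum fun i s => μ.real (X i ⁻¹' {s})]
    simp [sum_measureReal_fiber μ (hX _)]
  · have h1 : ∀ w : ι → S, μ.real ((fun ω i => X i ω) ⁻¹' {w}) *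
        Real.log (∏ i, μ.real (X i ⁻¹' {w i})) =
        ∑ i, μ.real ((fun ω i => X i ω) ⁻¹' {w}) * Real.log (μ.real (X i ⁻¹' {w i})) := by
      intro w
      by_cases h0 : ∃ i, μ.real (X i ⁻¹' {w i}) = 0
      · obtain ⟨i, hi⟩ := h0
        have : μ.real ((fun ω i => X i ω) ⁻¹' {w}) = 0 :=
          le_antisymm ((hle w i).trans_eq hi) measureReal_nonneg
        simp [this]
      · push Not at h0
        rw [Real.log_prod fun i _ => h0 i, Finset.mul_sum]
    simp_rw [h1]
    rw [Finset.sum_comm, ← Finset.sum_neg_distrib]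
    refine Finset.sum_congr rfl fun i _ => ?_
    rw [sum_measureReal_fiber_mul μ hXm (fun w => w i)
      fun s => Real.log (μ.real (X i ⁻¹' {s})), shannon, ← Finset.sum_neg_distrib]
    simp [Real.negMulLog]

lemma shannon_prod_le (μ : Measure Ω) [IsProbabilityMeasure μ] {X : Ω → S} {Y : Ω → T}
    (hX : Measurable X) (hY : Measurable Y) :
    shannon μ (fun ω => (X ω, Y ω)) ≤ shannon μ X + shannon μ Y := by
  have hXY : Measurable fun ω => (X ω, Y ω) := hX.prodMk hY
  have hle₁ : ∀ w : S × T, μ.real ((fun ω => (X ω, Y ω)) ⁻¹' {w}) ≤ μ.real (X ⁻¹' {w.1}) :=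
    fun w => measureReal_mono fun ω hω => congrArg Prod.fst (Set.mem_singleton_iff.1 hω)
  have hle₂ : ∀ w : S × T, μ.real ((fun ω => (X ω, Y ω)) ⁻¹' {w}) ≤ μ.real (Y ⁻¹' {w.2}) :=
    fun w => measureReal_mono fun ω hω => congrArg Prod.snd (Set.mem_singleton_iff.1 hω)
  refine (sum_negMulLog_le_of_sum_le _ (fun w => μ.real (X ⁻¹' {w.1}) * μ.real (Y ⁻¹' {w.2}))
    (fun _ => measureReal_nonneg) (fun w => by positivity) (fun w hw => ?_) ?_).trans_eq ?_
  · rcases mul_eq_zero.1 hw with h | h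
    · exact le_antisymm ((hle₁ w).trans_eq h) measureReal_nonneg
    · exact le_antisymm ((hle₂ w).trans_eq h) measureReal_nonneg
  · rw [sum_measureReal_fiber μ hXY, Fintype.sum_prod_type]
    simp [← Finset.mul_sum, sum_measureReal_fiber μ hX, sum_measureReal_fiber μ hY]
  · have h1 : ∀ w : S × T, μ.real ((fun ω => (X ω, Y ω)) ⁻¹' {w}) *
        Real.log (μ.real (X ⁻¹' {w.1}) * μ.real (Y ⁻¹' {w.2})) =
        μ.real ((fun ω => (X ω, Y ω)) ⁻¹' {w}) * Real.log (μ.real (X ⁻¹' {w.1})) +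
        μ.real ((fun ω => (X ω, Y ω)) ⁻¹' {w}) * Real.log (μ.real (Y ⁻¹' {w.2})) := by
      intro w
      by_cases h0 : μ.real ((fun ω => (X ω, Y ω)) ⁻¹' {w}) = 0
      · simp [h0]
      · have hpos := measureReal_nonneg.lt_of_ne' h0
        rw [Real.log_mul (hpos.trans_le (hle₁ w)).ne' (hpos.trans_le (hle₂ w)).ne', mul_add]
    simp_rw [h1]
    rw [Finset.sum_add_distrib, neg_add,
      sum_measureReal_fiber_mul μ hXY Prod.fst fun s => Real.log (μ.real (X ⁻¹' {s})),
      sum_measureReal_fiber_mul μ hXY Prod.snd fun s => Real.log (μ.real (Y ⁻¹' {s})),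
      shannon, shannon, ← Finset.sum_neg_distrib, ← Finset.sum_neg_distrib]
    simp [Real.negMulLog]

lemma shannon_le_log_card (μ : Measure Ω) [IsProbabilityMeasure μ] {X : Ω → S}
    (hX : Measurable X) : shannon μ X ≤ Real.log (Fintype.card S) := by
  have hne : Nonempty S := (nonempty_of_isProbabilityMeasure μ).map X
  have hc : (Fintype.card S : ℝ) ≠ 0 := by simp
  refine (sum_negMulLog_le_of_sum_le _ (fun _ => (Fintype.card S : ℝ)⁻¹)
    (fun _ => measureReal_nonneg) (fun w => by positivity)
    (fun w hw => absurd hw (inv_ne_zero hc)) ?_).trans_eq ?_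
  · rw [sum_measureReal_fiber μ hX]
    simp
  · rw [← Finset.sum_mul, sum_measureReal_fiber μ hX]
    simp

lemma shannon_mem (μ : Measure Ω) [IsProbabilityMeasure μ] {D : Set Ω} (hD : MeasurableSet D) :
    shannon μ (fun ω => ω ∈ D) = Real.binEntropy (μ.real D) := by
  have h1 : (fun ω => ω ∈ D) ⁻¹' {True} = D := by ext; simp
  have h2 : (fun ω => ω ∈ D) ⁻¹' {False} = Dᶜ := by ext; simp
  rw [shannon, Real.binEntropy_eq_negMulLog_add_negMulLog_one_sub, ← probReal_compl_eq_one_sub hD]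
  simp [Fintype.univ_Prop, h1, h2]

end Shannon

/-! ### The conditional law of the first letter given the tail. -/

section Density

lemma shift_iterate_apply {A : Type*} (i : ℕ) (a : ℕ → A) (n : ℕ) : shift^[i] a n = a (n + i) := by
  induction i generalizing a with
  | zero => rfl
  | succ i ih =>
    rw [Function.iterate_succ_apply, ih]
    exact congrArg a (by omega)

lemma measurable_shift {A : Type*} [MeasurableSpace A] : Measurable (shift (A := A)) :=
  measurable_pi_lambda _ fun n => measurable_pi_apply (n + 1)

variable {A : Type*} [Finite A] [MeasurableSpace A] [DiscreteMeasurableSpace A]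
  {μ : Measure (ℕ → A)} [IsProbabilityMeasure μ]

/-- `p` is a version of the conditional law of the coordinate `a 0` given `shift a`. -/
structure IsTailDensity (μ : Measure (ℕ → A)) (p : A → (ℕ → A) → ℝ) : Prop where
  measurable : ∀ x, Measurable (p x)
  nonneg : ∀ x c, 0 ≤ p x c
  le_one : ∀ x c, p x c ≤ 1
  integral_eq : ∀ x (g : (ℕ → A) → ℝ), Measurable g → (∃ K, ∀ c, |g c| ≤ K) →
    ∫ a, {b : ℕ → A | b 0 = x}.indicator (fun b => g (shift b)) a ∂μ = ∫ c, p x c * g c ∂μ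

lemma measurableSet_zero_eq (x : A) : MeasurableSet {b : ℕ → A | b 0 = x} :=
  measurableSet_eq_fun (measurable_pi_apply 0) measurable_const

/-- By shift-invariance, the image under `shift` of μ restricted to `{b | b 0 = x}` is dominated by
μ, so its Radon–Nikodym derivative is at most 1 a.e.; truncating at 1 makes the bound hold
everywhere. -/
lemma exists_isTailDensity (hσ : MeasurePreserving (shift (A := A)) μ μ) :
    ∃ p, IsTailDensity μ p := by
  let ρ : A → Measure (ℕ → A) := fun x => (μ.restrict {b | b 0 = x}).map shift
  have hρ : ∀ x, ρ x ≤ μ := fun x =>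
    (Measure.map_mono Measure.restrict_le_self measurable_shift).trans_eq hσ.map_eq
  have : ∀ x, IsFiniteMeasure (ρ x) := fun x => isFiniteMeasure_of_le μ (hρ x)
  refine ⟨fun x c => min 1 ((ρ x).rnDeriv μ c).toReal, fun x => ?_, fun x c => ?_, fun x c => ?_,
    fun x g hg _ => ?_⟩
  · exact measurable_const.min ((ρ x).measurable_rnDeriv μ).ennreal_toReal
  · exact le_min zero_le_one ENNReal.toReal_nonneg
  · exact min_le_left _ _
  · rw [integral_indicator (measurableSet_zero_eq x),
      ← integral_map measurable_shift.aemeasurable hg.aestronglyMeasurable,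
      ← integral_rnDeriv_smul (hρ x).absolutelyContinuous]
    refine integral_congr_ae ?_
    filter_upwards [Measure.rnDeriv_le_one_of_le (hρ x)] with c hc
    have : ((ρ x).rnDeriv μ c).toReal ≤ 1 := 
      ENNReal.toReal_le_of_le_ofReal zero_le_one (by simpa using hc)
    simp only [smul_eq_mul, min_eq_right this]

variable {p : A → (ℕ → A) → ℝ}

omit [Finite A] [DiscreteMeasurableSpace A] in
lemma integrable_of_abs_le {g : (ℕ → A) → ℝ} (hg : Measurable g) {K : ℝ} (hK : ∀ c, |g c| ≤ K) :
    Integrable g μ :=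
  Integrable.of_bound hg.aestronglyMeasurable K (Eventually.of_forall hK)

omit [Finite A] [DiscreteMeasurableSpace A] [IsProbabilityMeasure μ] in
lemma IsTailDensity.abs_le_one (hp : IsTailDensity μ p) (x : A) (c : ℕ → A) : |p x c| ≤ 1 :=
  abs_le.2 ⟨by linarith [hp.nonneg x c], hp.le_one x c⟩

omit [Finite A] [DiscreteMeasurableSpace A] [IsProbabilityMeasure μ] in
lemma IsTailDensity.abs_mul_le (hp : IsTailDensity μ p) (x : A) (c : ℕ → A) {r K : ℝ}
    (h : |r| ≤ K) : |p x c * r| ≤ K := by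
  rw [abs_mul]
  calc |p x c| * |r| ≤ 1 * |r| := by gcongr; exact hp.abs_le_one x c
    _ ≤ K := by simpa using h

omit [IsProbabilityMeasure μ] in
lemma IsTailDensity.measurable_comp (hp : IsTailDensity μ p) {f : (ℕ → A) → A}
    (hf : Measurable f) {τ : (ℕ → A) → ℕ → A} (hτ : Measurable τ) :
    Measurable fun c => p (f c) (τ c) := by
  have : Measurable fun q : A × (ℕ → A) => p q.1 q.2 :=
    measurable_from_prod_countable_right hp.measurable
  exact this.comp (hf.prodMk hτ)

lemma IsTailDensity.sum_eq_one [Fintype A] (hp : IsTailDensity μ p)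
    (hσ : MeasurePreserving (shift (A := A)) μ μ) : ∀ᵐ c ∂μ, ∑ x, p x c = 1 := by
  have hm : Measurable fun c => ∑ x, p x c := Finset.measurable_sum _ fun x _ => hp.measurable x
  have hb : ∀ c, |∑ x, p x c| ≤ Fintype.card A := fun c => by
    refine (Finset.abs_sum_le_sum_abs _ _).trans ?_
    refine (Finset.sum_le_sum fun x _ => hp.abs_le_one x c).trans ?_
    simp
  refine Integrable.ae_eq_of_forall_setIntegral_eq _ _ (integrable_of_abs_le hm hb)
    (integrable_const 1) fun B hB _ => ?_
  have hgm : Measurable (B.indicator (1 : (ℕ → A) → ℝ)) := measurable_one.indicator hB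
  have hgb : ∀ c, |B.indicator (1 : (ℕ → A) → ℝ) c| ≤ 1 := fun c => by
    by_cases h : c ∈ B <;> simp [h]
  have h := fun x => hp.integral_eq x _ hgm ⟨1, hgb⟩
  calc ∫ c in B, ∑ x, p x c ∂μ = ∫ c, ∑ x, p x c * B.indicator 1 c ∂μ := by
        rw [← integral_indicator hB]
        refine integral_congr_ae (Eventually.of_forall fun c => ?_)
        by_cases hc : c ∈ B <;> simp [hc]
    _ = ∑ x, ∫ c, p x c * B.indicator 1 c ∂μ := integral_finsetSum _ fun x _ =>
        integrable_of_abs_le ((hp.measurable x).mul hgm) fun c => hp.abs_mul_le x c (hgb c)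
    _ = ∑ x, ∫ a, {b : ℕ → A | b 0 = x}.indicator (fun b => B.indicator 1 (shift b)) a ∂μ := by
        simp_rw [h]
    _ = ∫ a, ∑ x, {b : ℕ → A | b 0 = x}.indicator (fun b => B.indicator 1 (shift b)) a ∂μ := by
        refine (integral_finsetSum _ fun x _ => ?_).symm
        refine integrable_of_abs_le ((hgm.comp measurable_shift).indicator
          (measurableSet_zero_eq x)) (K := 1) fun c => ?_
        by_cases hc : c 0 = x <;> by_cases hc' : shift c ∈ B <;> simp [hc, hc']
    _ = ∫ a, B.indicator (1 : (ℕ → A) → ℝ) (shift a) ∂μ := by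
        classical
        refine integral_congr_ae (Eventually.of_forall fun a => ?_)
        simp [Set.indicator_apply]
    _ = ∫ c, B.indicator (1 : (ℕ → A) → ℝ) c ∂μ := by
        rw [← integral_map measurable_shift.aemeasurable hgm.aestronglyMeasurable, hσ.map_eq]
    _ = ∫ c in B, 1 ∂μ := integral_indicator hB

/-! ### Equivariance under the automaton, ergodicity, and the resulting subgroup. -/

section Group

variable [Group A]

lemma measurable_multCA : Measurable (multCA (A := A)) :=
  measurable_pi_lambda _ fun n =>
    (Measurable.of_discrete (f := fun q : A × A => q.1 * q.2)).comp
      (g := fun q : A × A => q.1 * q.2) (f := fun a : ℕ → A => (a n, a (n + 1)))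
      ((measurable_pi_apply n).prodMk (measurable_pi_apply (n + 1)))

/-- As the left side is also the integral of `p y (multCA c) * g (multCA c)`, this identifies `p y
(multCA c)` as the conditional expectation of `p (y * (c 0)⁻¹) c` given `multCA c`. -/
lemma IsTailDensity.integral_multCA (hp : IsTailDensity μ p)
    (hΦ : MeasurePreserving (multCA (A := A)) μ μ) (y : A) {g : (ℕ → A) → ℝ} (hg : Measurable g)
    {K : ℝ} (hK : ∀ c, |g c| ≤ K) :
    ∫ c, p y c * g c ∂μ = ∫ c, p (y * (c 0)⁻¹) c * g (multCA c) ∂μ := by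
  classical
  have := Fintype.ofFinite A
  have hcomp : ∀ {f : (ℕ → A) → ℝ}, Measurable f → ∫ a, f (multCA a) ∂μ = ∫ a, f a ∂μ := by
    intro f hf
    rw [← integral_map measurable_multCA.aemeasurable hf.aestronglyMeasurable, hΦ.map_eq]
  let G : A → (ℕ → A) → ℝ := fun z => {b : ℕ → A | b 0 = z}.indicator fun b => g (multCA b)
  have hGm : ∀ z, Measurable (G z) := fun z =>
    (hg.comp measurable_multCA).indicator (measurableSet_zero_eq z)
  have hGb : ∀ z c, |G z c| ≤ K := fun z c => by
    by_cases h : c 0 = z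
    · simpa [G, h] using hK _
    · simpa [G, h] using (abs_nonneg _).trans (hK c)
  calc ∫ c, p y c * g c ∂μ
      = ∫ a, {b : ℕ → A | b 0 = y}.indicator (fun b => g (shift b)) a ∂μ :=
        (hp.integral_eq y g hg ⟨K, hK⟩).symm
    _ = ∫ a, {b : ℕ → A | b 0 = y}.indicator (fun b => g (shift b)) (multCA a) ∂μ :=
        (hcomp ((hg.comp measurable_shift).indicator (measurableSet_zero_eq y))).symm
    -- Splitting by the value z of `a 1` turns the event `a 0 * a 1 = y` into `a 0 = y * z⁻¹` with a
    -- fixed letter, to which `integral_eq` applies.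
    _ = ∫ a, ∑ z, {b : ℕ → A | b 0 = y * z⁻¹}.indicator (fun b => G z (shift b)) a ∂μ := by
        refine integral_congr_ae (Eventually.of_forall fun a => ?_)
        dsimp only
        rw [Finset.sum_eq_single (a 1)]
        · simp [Set.indicator_apply, G, multCA, shift, eq_mul_inv_iff_mul_eq]
          rfl
        · intro z _ hz
          have : shift a ∉ {b : ℕ → A | b 0 = z} := fun h => hz h.symm
          simp [Set.indicator_apply, G]
          intro _ h
          exact absurd h this
        · simp
    _ = ∑ z, ∫ a, {b : ℕ → A | b 0 = y * z⁻¹}.indicator (fun b => G z (shift b)) a ∂μ := by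
        refine integral_finsetSum _ fun z _ => ?_
        refine integrable_of_abs_le (((hGm z).comp measurable_shift).indicator
          (measurableSet_zero_eq _)) (K := K) fun c => ?_
        by_cases h : c 0 = y * z⁻¹
        · simpa [h] using hGb _ _
        · simpa [h] using (abs_nonneg _).trans (hK c)
    _ = ∑ z, ∫ c, p (y * z⁻¹) c * G z c ∂μ :=
        Finset.sum_congr rfl fun z _ => hp.integral_eq _ _ (hGm z) ⟨K, hGb z⟩
    _ = ∫ c, ∑ z, p (y * z⁻¹) c * G z c ∂μ :=
        (integral_finsetSum _ fun z _ => integrable_of_abs_le ((hp.measurable _).mul (hGm z))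
          fun c => hp.abs_mul_le _ c (hGb z c)).symm
    _ = ∫ c, p (y * (c 0)⁻¹) c * g (multCA c) ∂μ := by
        refine integral_congr_ae (Eventually.of_forall fun c => ?_)
        dsimp only
        rw [Finset.sum_eq_single (c 0)]
        · simp [G]
        · intro z _ hz
          simp [G, Ne.symm hz]
        · simp

/-- The conditional law of `a 0` given `shift a` is equivariant under the cellular automaton. -/
lemma IsTailDensity.multCA_ae_eq (hp : IsTailDensity μ p)
    (hΦ : MeasurePreserving (multCA (A := A)) μ μ) :
    ∀ᵐ c ∂μ, ∀ y, p y (multCA c) = p (y * (c 0)⁻¹) c := by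
  have := Fintype.ofFinite A
  have hcomp : ∀ {f : (ℕ → A) → ℝ}, Measurable f → ∫ a, f (multCA a) ∂μ = ∫ a, f a ∂μ := by
    intro f hf
    rw [← integral_map measurable_multCA.aemeasurable hf.aestronglyMeasurable, hΦ.map_eq]
  have hm : ∀ y, Measurable fun c => p y (multCA c) := fun y =>
    (hp.measurable y).comp measurable_multCA
  have hm' : ∀ y, Measurable fun c : ℕ → A => p (y * (c 0)⁻¹) c := fun y =>
    hp.measurable_comp ((Measurable.of_discrete (f := fun x : A => y * x⁻¹)).comp
      (measurable_pi_apply 0)) measurable_id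
  have hI₁ : ∀ y, Integrable (fun c => p y (multCA c) * p y (multCA c)) μ := fun y =>
    integrable_of_abs_le ((hm y).mul (hm y)) fun c => hp.abs_mul_le _ _ (hp.abs_le_one _ _)
  have hI₂ : ∀ y, Integrable (fun c => p (y * (c 0)⁻¹) c * p y (multCA c)) μ := fun y =>
    integrable_of_abs_le ((hm' y).mul (hm y)) fun c => hp.abs_mul_le _ _ (hp.abs_le_one _ _)
  have hI₃ : ∀ y, Integrable (fun c => p (y * (c 0)⁻¹) c * p (y * (c 0)⁻¹) c) μ := fun y =>
    integrable_of_abs_le ((hm' y).mul (hm' y)) fun c => hp.abs_mul_le _ _ (hp.abs_le_one _ _)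
  have hI₄ : ∀ y, Integrable (fun c => p y c * p y c) μ := fun y =>
    integrable_of_abs_le ((hp.measurable y).mul (hp.measurable y))
      fun c => hp.abs_mul_le _ _ (hp.abs_le_one _ _)
  -- Norms need not match for a single `y`, but `y ↦ y * (c 0)⁻¹` permutes the letters, so they
  -- match after summation.
  let D : (ℕ → A) → ℝ := fun c => ∑ y, (p y (multCA c) - p (y * (c 0)⁻¹) c) ^ 2
  have hD0 : ∀ c, 0 ≤ D c := fun c => Finset.sum_nonneg fun y _ => sq_nonneg _
  have hDeq : D = fun c => ∑ y, (p y (multCA c) * p y (multCA c)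
      - 2 * (p (y * (c 0)⁻¹) c * p y (multCA c)))
      + ∑ y, p (y * (c 0)⁻¹) c * p (y * (c 0)⁻¹) c := by
    funext c
    rw [← Finset.sum_add_distrib]
    exact Finset.sum_congr rfl fun y _ => by ring
  have hterm : ∀ y, ∫ c, (p y (multCA c) * p y (multCA c)
      - 2 * (p (y * (c 0)⁻¹) c * p y (multCA c))) ∂μ = -∫ c, p y c * p y c ∂μ := by
    intro y
    rw [integral_sub (hI₁ y) ((hI₂ y).const_mul 2), integral_const_mul,
      ← hp.integral_multCA hΦ y (hp.measurable y) (hp.abs_le_one y),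
      hcomp (f := fun c => p y c * p y c) ((hp.measurable y).mul (hp.measurable y))]
    ring
  have hperm : ∀ c : ℕ → A, ∑ y, p (y * (c 0)⁻¹) c * p (y * (c 0)⁻¹) c = ∑ y, p y c * p y c :=
    fun c => Equiv.sum_comp (Equiv.mulRight (c 0)⁻¹) fun y => p y c * p y c
  have hDi : Integrable D μ := by
    rw [hDeq]
    exact (integrable_finsetSum _ fun y _ => (hI₁ y).sub ((hI₂ y).const_mul 2)).add
      (integrable_finsetSum _ fun y _ => hI₃ y)
  have hDint : ∫ c, D c ∂μ = 0 := by
    have hsplit : ∫ c, D c ∂μ = ∫ c, ∑ y, (p y (multCA c) * p y (multCA c)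
        - 2 * (p (y * (c 0)⁻¹) c * p y (multCA c))) ∂μ
        + ∫ c, ∑ y, p (y * (c 0)⁻¹) c * p (y * (c 0)⁻¹) c ∂μ := by
      rw [hDeq]
      exact integral_add (integrable_finsetSum _ fun y _ => (hI₁ y).sub ((hI₂ y).const_mul 2))
        (integrable_finsetSum _ fun y _ => hI₃ y)
    have hsum : ∫ c, ∑ y, (p y (multCA c) * p y (multCA c)
        - 2 * (p (y * (c 0)⁻¹) c * p y (multCA c))) ∂μ = ∑ y, -∫ c, p y c * p y c ∂μ := by
      simp_rw [← hterm]
      exact integral_finsetSum _ fun y _ => (hI₁ y).sub ((hI₂ y).const_mul 2)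
    rw [hsplit, hsum]
    simp_rw [hperm]
    rw [integral_finsetSum _ fun y _ => hI₄ y, Finset.sum_neg_distrib, neg_add_cancel]
  filter_upwards [(integral_eq_zero_iff_of_nonneg hD0 hDi).1 hDint] with c hc y
  have := (Finset.sum_eq_zero_iff_of_nonneg fun y _ => sq_nonneg _).1 hc y (Finset.mem_univ y)
  exact sub_eq_zero.1 (pow_eq_zero_iff two_ne_zero |>.1 this)

/-- If the automaton is ergodic, the conditional law of `a 0` given `shift a`, seen from `a 0`,
is almost surely constant. -/
lemma IsTailDensity.exists_const (hp : IsTailDensity μ p)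
    (hσ : MeasurePreserving (shift (A := A)) μ μ) (hΦ : Ergodic (multCA (A := A)) μ) :
    ∃ η : A → ℝ, ∀ᵐ a ∂μ, ∀ g, p (g * a 0) (shift a) = η g := by
  have hm : ∀ g, Measurable fun a : ℕ → A => p (g * a 0) (shift a) := fun g =>
    hp.measurable_comp ((Measurable.of_discrete (f := fun x : A => g * x)).comp
      (measurable_pi_apply 0)) measurable_shift
  have h : ∀ g, ∃ r : ℝ, (fun a : ℕ → A => p (g * a 0) (shift a)) =ᵐ[μ] fun _ => r := by
    intro g
    refine hΦ.ae_eq_const_of_ae_eq_comp_ae (hm g).aestronglyMeasurable ?_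
    filter_upwards [hσ.quasiMeasurePreserving.ae (hp.multCA_ae_eq hΦ.toMeasurePreserving)]
      with a ha
    -- Equivariance at the tail `shift a`, whose first letter is `a 1`, cancels the factor `a 1`.
    change p (g * (a 0 * a 1)) (multCA (shift a)) = p (g * a 0) (shift a)
    rw [ha]
    simp [shift, mul_assoc]
  choose η hη using h
  exact ⟨η, ae_all_iff.2 hη⟩

-- Passes from random sequences to tails: the letters `x` with `p x c ≠ 0` are those that can
-- precede `c`, and an exceptional set of tails would give positive mass to exceptional sequences.
omit [DiscreteMeasurableSpace A] in
lemma IsTailDensity.ae_of_ne_zero (hp : IsTailDensity μ p) {η : A → ℝ}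
    (hη : ∀ᵐ a ∂μ, ∀ g, p (g * a 0) (shift a) = η g) :
    ∀ᵐ c ∂μ, ∀ x, p x c ≠ 0 → ∀ g, p (g * x) c = η g := by
  refine ae_all_iff.2 fun x => ?_
  let B : Set (ℕ → A) := {c | ∀ g, p (g * x) c = η g}ᶜ
  have hB : MeasurableSet B := by
    refine MeasurableSet.compl ?_
    rw [Set.ofPred_forall]
    exact MeasurableSet.iInter fun g => measurableSet_eq_fun (hp.measurable _) measurable_const
  have hgm : Measurable (B.indicator (1 : (ℕ → A) → ℝ)) := measurable_one.indicator hB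
  have hgb : ∀ c, |B.indicator (1 : (ℕ → A) → ℝ) c| ≤ 1 := fun c => by
    by_cases h : c ∈ B <;> simp [h]
  have h0 : ∫ c, p x c * B.indicator 1 c ∂μ = 0 := by
    rw [← hp.integral_eq x _ hgm ⟨1, hgb⟩]
    refine integral_eq_zero_of_ae ?_
    filter_upwards [hη] with a ha
    by_cases hx : a 0 = x
    · have : shift a ∉ B := fun h => h fun g => hx ▸ ha g
      simp [this]
    · simp [hx]
  have h1 := (integral_eq_zero_iff_of_nonneg (fun c => mul_nonneg (hp.nonneg x c)
    (Set.indicator_nonneg (fun _ _ => zero_le_one) c))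
    (integrable_of_abs_le ((hp.measurable x).mul hgm) fun c => hp.abs_mul_le x c (hgb c))).1 h0
  filter_upwards [h1] with c hc hne
  by_contra hcB
  have : c ∈ B := hcB
  simp [this, hne] at hc

/-- The support of the constant conditional law is a subgroup, on which the law is uniform. -/
lemma IsTailDensity.exists_subgroup (hp : IsTailDensity μ p)
    (hσ : MeasurePreserving (shift (A := A)) μ μ) (hΦ : Ergodic (multCA (A := A)) μ) :
    ∃ (C : Subgroup A) (r : ℝ),
      (∀ᵐ c ∂μ, ∀ x, p x c ≠ 0 → ∀ g ∈ C, p (g * x) c = r) ∧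
      ∀ᵐ a ∂μ, ∀ s, p s (shift a) ≠ 0 ↔ s * (a 0)⁻¹ ∈ C := by
  have := Fintype.ofFinite A
  obtain ⟨η, hη⟩ := hp.exists_const hσ hΦ
  have hae := hp.ae_of_ne_zero hη
  obtain ⟨c, hc, hsum⟩ := (hae.and (hp.sum_eq_one hσ)).exists
  obtain ⟨x, -, hx⟩ := Finset.exists_ne_zero_of_sum_ne_zero (hsum.trans_ne one_ne_zero)
  have h1 : η 1 ≠ 0 := by rw [← hc x hx 1, one_mul]; exact hx
  -- Both `x` and `g * x` are charged at `c`, so either may serve as base point; comparing them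
  -- gives right invariance of η under its support.
  have hmul : ∀ g, η g ≠ 0 → ∀ h, η (h * g) = η h := by
    intro g hg h
    rw [← hc x hx g] at hg
    rw [← hc x hx (h * g), mul_assoc, hc _ hg]
  have hone : ∀ g, η g ≠ 0 → η g = η 1 := fun g hg => by simpa using hmul g hg 1
  let C : Subgroup A :=
    { carrier := {g | η g ≠ 0}
      one_mem' := h1
      mul_mem' := fun {a b} ha hb => by
        change η (a * b) ≠ 0
        rw [hmul b hb]; exact ha
      inv_mem' := fun {g} hg => by
        change η g⁻¹ ≠ 0
        rw [← hmul g hg, inv_mul_cancel]; exact h1 }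
  refine ⟨C, η 1, ?_, ?_⟩
  · filter_upwards [hae] with c hc x hx g hg
    rw [hc x hx, hone g hg]
  · filter_upwards [hη] with a ha s
    have := ha (s * (a 0)⁻¹)
    rw [inv_mul_cancel_right] at this
    rw [this]
    rfl

/-- A shift-invariant measure whose first coordinate is uniform given the others is the uniform
Bernoulli measure. -/
lemma IsTailDensity.eq_uniformMeasure (hp : IsTailDensity μ p)
    (hσ : MeasurePreserving (shift (A := A)) μ μ) {r : ℝ} (hr : ∀ᵐ c ∂μ, ∀ x, p x c = r) :
    μ = uniformMeasure A := by
  have := Fintype.ofFinite A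
  obtain ⟨c, hc, hsum⟩ := (hr.and (hp.sum_eq_one hσ)).exists
  have hr' : r = (Fintype.card A : ℝ)⁻¹ := by
    simp only [hc, Finset.sum_const, Finset.card_univ, nsmul_eq_mul] at hsum
    exact eq_inv_of_mul_eq_one_right hsum
  have hind : ∀ (x : A) (B : Set (ℕ → A)), MeasurableSet B →
      μ.real ({b | b 0 = x} ∩ shift ⁻¹' B) = (Fintype.card A : ℝ)⁻¹ * μ.real B := by
    intro x B hB
    have hgm : Measurable (B.indicator (1 : (ℕ → A) → ℝ)) := measurable_one.indicator hB
    have h := hp.integral_eq x _ hgm ⟨1, fun c => by by_cases h : c ∈ B <;> simp [h]⟩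
    have h2 : ∫ c, p x c * B.indicator 1 c ∂μ = (Fintype.card A : ℝ)⁻¹ * μ.real B := by
      rw [← hr', ← integral_indicator_one hB, ← integral_const_mul]
      refine integral_congr_ae ?_
      filter_upwards [hr] with c hc
      rw [hc x]
    rw [← h2, ← h, ← integral_indicator_one ((measurableSet_zero_eq x).inter (measurable_shift hB))]
    refine integral_congr_ae (Eventually.of_forall fun a => ?_)
    by_cases h1 : a 0 = x <;> by_cases h2 : shift a ∈ B <;> simp [h1, h2]
  have hindset : ∀ (t : Set A) (B : Set (ℕ → A)), MeasurableSet B →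
      μ ({b | b 0 ∈ t} ∩ shift ⁻¹' B) = uniformOn (Set.univ : Set A) t * μ B := by
    classical
    intro t B hB
    have hu : {b : ℕ → A | b 0 ∈ t} ∩ shift ⁻¹' B =
        ⋃ x ∈ t.toFinset, ({b | b 0 = x} ∩ shift ⁻¹' B) := by
      ext b; simp
    have hx : ∀ x, μ ({b | b 0 = x} ∩ shift ⁻¹' B) = (Fintype.card A : ENNReal)⁻¹ * μ B := by
      intro x
      rw [← ENNReal.toReal_eq_toReal_iff' (by finiteness)
        (ENNReal.mul_ne_top (by simp) (by finiteness))]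
      simpa [Measure.real] using hind x B hB
    rw [hu, measure_biUnion_finset]
    · rw [uniformOn_univ, Finset.sum_congr rfl fun x _ => hx x, Finset.sum_const, nsmul_eq_mul,
        ← mul_assoc, div_eq_mul_inv]
      congr 2
      rw [← Measure.count_apply_finset, Set.coe_toFinset]
    · intro x _ y _ hxy
      refine Set.disjoint_left.2 fun b hb hb' => hxy ?_
      exact hb.1.symm.trans hb'.1
    · exact fun x _ => (measurableSet_zero_eq x).inter (measurable_shift hB)
  have hcyl : ∀ (n : ℕ) (t : ℕ → Set A), μ {b | ∀ i < n, b i ∈ t i} =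
      ∏ i ∈ Finset.range n, uniformOn (Set.univ : Set A) (t i) := by
    intro n
    induction n with
    | zero => simp
    | succ n ih =>
      intro t
      have hset : {b : ℕ → A | ∀ i < n + 1, b i ∈ t i} =
          {b | b 0 ∈ t 0} ∩ shift ⁻¹' {b | ∀ i < n, b i ∈ t (i + 1)} := by
        ext b
        constructor
        · exact fun h => ⟨h 0 (Nat.succ_pos n), fun i hi => h (i + 1) (Nat.succ_lt_succ hi)⟩
        · rintro ⟨h0, h1⟩ (_ | i) hi
          · exact h0
          · exact h1 i (Nat.lt_of_succ_lt_succ hi)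
      have hmeas : MeasurableSet {b : ℕ → A | ∀ i < n, b i ∈ t (i + 1)} := by
        simp only [Set.ofPred_forall]
        exact MeasurableSet.iInter fun i => MeasurableSet.iInter fun _ =>
          (measurable_pi_apply i) (MeasurableSet.of_discrete (s := t (i + 1)))
      rw [hset, hindset _ _ hmeas, ih fun i => t (i + 1), Finset.prod_range_succ', mul_comm]
  have : Nonempty A := ⟨c 0⟩
  refine Measure.eq_infinitePi _ fun s t _ => ?_
  classical
  -- Unconstrained coordinates below the bound receive `Set.univ`, which contributes a factor 1.
  have h := hcyl (s.sup id + 1) fun i => if i ∈ s then t i else Set.univ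
  have hlt : ∀ i ∈ s, i < s.sup id + 1 := fun i hi => Nat.lt_succ_of_le (Finset.le_sup (f := id) hi)
  have hset : Set.pi s t =
      {b : ℕ → A | ∀ i < s.sup id + 1, b i ∈ if i ∈ s then t i else Set.univ} := by
    ext b
    constructor
    · intro hb i _
      by_cases hi : i ∈ s
      · simpa [hi] using hb i hi
      · simp [hi]
    · intro hb i hi
      have := hb i (hlt i hi)
      rwa [if_pos (by simpa using hi)] at this
  rw [hset, h]
  have hsub : s ⊆ Finset.range (s.sup id + 1) := fun i hi => Finset.mem_range.2 (hlt i hi)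
  rw [← Finset.prod_subset hsub fun i _ hi => by simp [hi]]
  exact Finset.prod_congr rfl fun i hi => by simp [hi]

end Group

end Density

/-! ### Approximation of measurable sets by cylinders. -/

section Approximation

lemma mem_iff_mem_of_symmDiff {X : Type*} {L E : Set X} {a b : X} (hE : a ∈ E ↔ b ∈ E)
    (hD : a ∈ symmDiff L E ↔ b ∈ symmDiff L E) : a ∈ L ↔ b ∈ L := by
  rw [Set.mem_symmDiff, Set.mem_symmDiff] at hD
  tauto

lemma exists_approx_of_depends_on_initial {A : Type*} [MeasurableSpace A] (μ : Measure (ℕ → A))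
    [IsFiniteMeasure μ] {L : Set (ℕ → A)} (hL : MeasurableSet L) {δ : ℝ} (hδ : 0 < δ) :
    ∃ (m : ℕ) (E : Set (ℕ → A)), MeasurableSet E ∧
      (∀ a b : ℕ → A, (∀ i < m, a i = b i) → (a ∈ E ↔ b ∈ E)) ∧
      μ.real (symmDiff L E) < δ := by
  have halg : IsSetAlgebra (measurableCylinders fun _ : ℕ => A) :=
    { empty_mem := empty_mem_measurableCylinders _
      compl_mem := fun _ => compl_mem_measurableCylinders
      union_mem := fun _ _ => union_mem_measurableCylinders }
  obtain ⟨E, hE, hlt⟩ := (Measure.MeasureDense.of_generateFrom_isSetAlgebra_finite (μ := μ) halg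
    generateFrom_measurableCylinders.symm).approx L hL (by finiteness) δ hδ
  obtain ⟨s, S, -, rfl⟩ := (mem_measurableCylinders E).1 hE
  refine ⟨s.sup id + 1, _, MeasurableSet.of_mem_measurableCylinders hE, fun a b hab => ?_, ?_⟩
  · have : s.restrict a = s.restrict b := by
      funext i
      exact hab i (Nat.lt_succ_of_le (Finset.le_sup (f := id) i.2))
    rw [mem_cylinder, mem_cylinder, this]
  · exact (ENNReal.toReal_lt_toReal (by finiteness) (by finiteness)).2 hlt |>.trans_eq
      (ENNReal.toReal_ofReal hδ.le)

lemma exists_approx_family {A ι : Type*} [MeasurableSpace A] [Fintype ι] (μ : Measure (ℕ → A))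
    [IsFiniteMeasure μ] {L : ι → Set (ℕ → A)} (hL : ∀ l, MeasurableSet (L l)) {δ : ℝ}
    (hδ : 0 < δ) :
    ∃ (m : ℕ) (E : ι → Set (ℕ → A)), (∀ l, MeasurableSet (E l)) ∧
      (∀ l, ∀ a b : ℕ → A, (∀ i < m, a i = b i) → (a ∈ E l ↔ b ∈ E l)) ∧
      ∀ l, μ.real (symmDiff (L l) (E l)) < δ := by
  choose m E hE hdep hlt using fun l => exists_approx_of_depends_on_initial μ (hL l) hδ
  refine ⟨Finset.univ.sup m, E, hE, fun l a b hab => hdep l a b fun i hi => ?_, hlt⟩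
  exact hab i (hi.trans_le (Finset.le_sup (Finset.mem_univ l)))

end Approximation

/-! ### The entropy bound from a tail that determines a coset. -/

section EntropyBound

lemma blockEntropy_eq_shannon_div {X : Type*} [MeasurableSpace X] (T : X → X) (μ : Measure X)
    {k : ℕ} (f : X → Fin k) (n : ℕ) :
    blockEntropy T μ f n =
      shannon μ (fun x (i : Fin n) => f (T^[(i : ℕ)] x)) / Real.log 2 := by
  have hset : ∀ w : Fin n → Fin k, {x | ∀ i : Fin n, f (T^[(i : ℕ)] x) = w i} =
      (fun x (i : Fin n) => f (T^[(i : ℕ)] x)) ⁻¹' {w} := by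
    intro w
    ext x
    exact funext_iff.symm
  simp_rw [blockEntropy, shannon, hset, Real.negMulLog, Real.logb, neg_mul, Finset.sum_neg_distrib,
    neg_div, Finset.sum_div, mul_div_assoc]

/-- A choice of representatives identifies each right coset of `C` with `C`. -/
lemma exists_injOn_rightCosets {A : Type*} [Group A] (C : Subgroup A) :
    ∃ κ : A → C, ∀ x y, x * y⁻¹ ∈ C → κ x = κ y → x = y := by
  let rep : A → A := fun x => (Quotient.mk (QuotientGroup.rightRel C) x).out
  have hrep : ∀ x, x * (rep x)⁻¹ ∈ C := fun x =>
    QuotientGroup.rightRel_apply.1 (Quotient.mk_out (s := QuotientGroup.rightRel C) x)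
  refine ⟨fun x => ⟨x * (rep x)⁻¹, hrep x⟩, fun x y hxy h => ?_⟩
  have hr : rep x = rep y := by
    have : (Quotient.mk (QuotientGroup.rightRel C) y) = Quotient.mk (QuotientGroup.rightRel C) x :=
      Quotient.sound (QuotientGroup.rightRel_apply.2 hxy)
    simp only [rep, this]
  have h' : x * (rep x)⁻¹ = y * (rep y)⁻¹ := congrArg Subtype.val h
  rw [hr] at h'
  exact mul_right_cancel h'

variable {A : Type*} [Group A] [Finite A] [MeasurableSpace A] [DiscreteMeasurableSpace A]
  {μ : Measure (ℕ → A)} [IsProbabilityMeasure μ]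

/-- The block is encoded by the last `M` letters and, at each position, a label in `C` for the
letter within its coset and rare error bits. Decoding runs from right to left: known letters and
error bits decide membership of the tail in `K s`, hence the coset of the preceding letter, and the
label picks it out. -/
lemma exists_shannon_le (hσ : MeasurePreserving (shift (A := A)) μ μ) {C : Subgroup A}
    {K : A → Set (ℕ → A)} (hK : ∀ s, MeasurableSet (K s))
    (hKC : ∀ᵐ a ∂μ, ∀ s, shift a ∈ K s ↔ s * (a 0)⁻¹ ∈ C) {k : ℕ} {f : (ℕ → A) → Fin k}
    (hf : Measurable f) {ε : ℝ} (hε : 0 < ε) :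
    ∃ β : ℝ, ∀ n : ℕ, shannon μ (fun x (i : Fin n) => f (shift^[(i : ℕ)] x)) ≤
      (n + 1) * (Real.log (Nat.card C) + ε) + β := by
  classical
  have := Fintype.ofFinite A
  -- The sets to approximate: the `K s`, used to decode letters, and the cells of `f`, used to read
  -- off the block.
  let ι := A ⊕ Fin k
  let L : ι → Set (ℕ → A) := Sum.elim K fun j => f ⁻¹' {j}
  have hL : ∀ l, MeasurableSet (L l) := by
    rintro (s | j)
    · exact hK s
    · exact hf (measurableSet_singleton j)
  let ε' : ℝ := ε / (Fintype.card ι + 1)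
  have hε' : 0 < ε' := by positivity
  -- An error bit of small probability has small entropy, by continuity of the binary entropy at 0.
  obtain ⟨δ, hδ, hbin⟩ : ∃ δ > 0, ∀ t : ℝ, 0 ≤ t → t < δ → Real.binEntropy t ≤ ε' := by
    obtain ⟨δ, hδ, h⟩ := Metric.continuous_iff.1 Real.binEntropy_continuous 0 ε' hε'
    refine ⟨δ, hδ, fun t ht htδ => ?_⟩
    have := h t (by rwa [Real.dist_eq, sub_zero, abs_of_nonneg ht])
    rw [Real.binEntropy_zero, Real.dist_eq, sub_zero] at this
    exact (le_abs_self _).trans this.le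
  obtain ⟨M, E, hE, hdep, hlt⟩ := exists_approx_family μ hL hδ
  obtain ⟨κ, hκ⟩ := exists_injOn_rightCosets C
  let D : ι → Set (ℕ → A) := fun l => symmDiff (L l) (E l)
  have hD : ∀ l, MeasurableSet (D l) := fun l => (hL l).symmDiff (hE l)
  let Z₁ : (ℕ → A) → C := fun a => κ (a 0)
  let Z₂ : (ℕ → A) → ι → Prop := fun a l => a ∈ D l
  let Z : (ℕ → A) → C × (ι → Prop) := fun a => (Z₁ a, Z₂ a)
  have hZ₁ : Measurable Z₁ := (Measurable.of_discrete (f := κ)).comp (measurable_pi_apply 0)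
  have hZ₂ : Measurable Z₂ := measurable_pi_lambda _ fun l => measurable_mem.2 (hD l)
  have hZ : Measurable Z := hZ₁.prodMk hZ₂
  have hZle : shannon μ Z ≤ Real.log (Nat.card C) + ε := by
    refine (shannon_prod_le μ hZ₁ hZ₂).trans (add_le_add ?_ ?_)
    · rw [Nat.card_eq_fintype_card]
      exact shannon_le_log_card μ hZ₁
    · refine (shannon_pi_le μ fun l => measurable_mem.2 (hD l)).trans ?_
      refine (Finset.sum_le_sum fun l _ => ?_).trans (b := ∑ _l : ι, ε') ?_
      · rw [shannon_mem μ (hD l)]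
        exact hbin _ measureReal_nonneg (hlt l)
      · rw [Finset.sum_const, Finset.card_univ, nsmul_eq_mul, mul_div_assoc',
          div_le_iff₀ (by positivity)]
        nlinarith
  refine ⟨Real.log (Fintype.card (Fin M → A)), fun n => ?_⟩
  -- Position `n` is included because the coset of the letter at `n - 1` is read from the tail
  -- starting at `n`.
  let W : (ℕ → A) → Fin (n + 1) → C × (ι → Prop) := fun a i => Z (shift^[(i : ℕ)] a)
  let R : (ℕ → A) → Fin M → A := fun a j => a (n + j)
  have hiter : ∀ i, Measurable (shift (A := A))^[i] := fun i => measurable_shift.iterate i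
  have hW : Measurable W := measurable_pi_lambda _ fun i => hZ.comp (hiter i)
  have hR : Measurable R := measurable_pi_lambda _ fun j => measurable_pi_apply (n + j)
  let G : Set (ℕ → A) := {a | ∀ i s, shift^[i + 1] a ∈ K s ↔ s * (a i)⁻¹ ∈ C}
  have hG : ∀ᵐ a ∂μ, a ∈ G := by
    have : ∀ i : ℕ, ∀ᵐ a ∂μ, ∀ s, shift^[i + 1] a ∈ K s ↔ s * (a i)⁻¹ ∈ C := by
      intro i
      filter_upwards [(hσ.iterate i).quasiMeasurePreserving.ae hKC] with a ha s
      rw [Function.iterate_succ_apply', ha s, shift_iterate_apply, zero_add]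
    exact ae_all_iff.2 this
  have hdet : shannon μ (fun x (i : Fin n) => f (shift^[(i : ℕ)] x)) ≤
      shannon μ fun a => (W a, R a) := by
    refine shannon_le_of_determined μ (hW.prodMk hR) hG fun a ha b hb hab => ?_
    have hWab : ∀ i ≤ n, Z (shift^[i] a) = Z (shift^[i] b) := fun i hi =>
      congrFun (congrArg Prod.fst hab) ⟨i, Nat.lt_succ_of_le hi⟩
    have hRab : ∀ j < M, a (n + j) = b (n + j) := fun j hj =>
      congrFun (congrArg Prod.snd hab) ⟨j, hj⟩
    have hmem : ∀ i ≤ n, (∀ j < M, a (i + j) = b (i + j)) → ∀ l,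
        (shift^[i] a ∈ L l ↔ shift^[i] b ∈ L l) := by
      intro i hi hj l
      have h1 : shift^[i] a ∈ E l ↔ shift^[i] b ∈ E l := by
        refine hdep l _ _ fun j hjM => ?_
        rw [shift_iterate_apply, shift_iterate_apply, add_comm j i]
        exact hj j hjM
      have h2 : (shift^[i] a ∈ D l) = (shift^[i] b ∈ D l) :=
        congrFun (congrArg Prod.snd (hWab i hi)) l
      exact mem_iff_mem_of_symmDiff h1 (iff_of_eq h2)
    have hlet : ∀ d ≤ n, ∀ j < M + d, a (n - d + j) = b (n - d + j) := by
      intro d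
      induction d with
      | zero => exact fun _ j hj => hRab j hj
      | succ d ih =>
        intro hd j hj
        have ih' := ih (by omega)
        rcases j with _ | j
        · have hL' := hmem (n - (d + 1) + 1) (by omega) fun j hj => by
            have := ih' j (by omega)
            rwa [show n - d = n - (d + 1) + 1 by omega] at this
          refine hκ _ _ ?_ ?_
          -- Taking `s` to be the letter of `a`: that letter lies in its own coset, membership in `K
          -- s` transfers to `b`, so both letters share a coset.
          · refine (hb _ _).1 ((hL' (Sum.inl _)).1 ((ha (n - (d + 1)) _).2 ?_))
            simp
          · have := congrArg Prod.fst (hWab (n - (d + 1)) (by omega))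
            simpa [Z, Z₁, shift_iterate_apply] using this
        · have := ih' j (by omega)
          rwa [show n - d + j = n - (d + 1) + (j + 1) by omega] at this
    funext i
    have := hmem i i.2.le (fun j hj => by
      have := hlet (n - i) (by omega) j (by omega)
      rwa [show n - (n - (i : ℕ)) = i by omega] at this) (Sum.inr (f (shift^[(i : ℕ)] a)))
    exact (this.1 rfl).symm
  refine hdet.trans ((shannon_prod_le μ hW hR).trans (add_le_add ?_ (shannon_le_log_card μ hR)))
  refine (shannon_pi_le μ fun i : Fin (n + 1) => hZ.comp (hiter i)).trans ?_
  have hstat : ∀ i : Fin (n + 1), shannon μ (Z ∘ shift^[(i : ℕ)]) = shannon μ Z := fun i =>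
    shannon_comp_measurePreserving (hσ.iterate i) hZ
  simp_rw [hstat]
  rw [Finset.sum_const, Finset.card_univ, Fintype.card_fin, nsmul_eq_mul]
  push_cast
  gcongr

/-- If the tail `shift a` almost surely determines the right coset `C * a 0`, then the entropy
of the shift is at most `log₂ |C|`. -/
theorem entropy_shift_le (hσ : MeasurePreserving (shift (A := A)) μ μ) {C : Subgroup A}
    {K : A → Set (ℕ → A)} (hK : ∀ s, MeasurableSet (K s))
    (hKC : ∀ᵐ a ∂μ, ∀ s, shift a ∈ K s ↔ s * (a 0)⁻¹ ∈ C) :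
    entropy (shift (A := A)) μ ≤ ((Real.logb 2 (Nat.card C) : ℝ) : EReal) := by
  refine iSup_le fun k => iSup_le fun f => iSup_le fun hf => ?_
  refine EReal.le_of_forall_lt_iff_le.1 fun z hz => ?_
  have hlog2 : 0 < Real.log 2 := Real.log_pos one_lt_two
  have hz' : Real.log (Nat.card C) < z * Real.log 2 := by
    have := EReal.coe_lt_coe_iff.1 hz
    rwa [Real.logb, div_lt_iff₀ hlog2] at this
  -- The choice ε = z log 2 - log |C| makes the bound (n + 1) z log 2 + β, with β independent of n.
  obtain ⟨β, hβ⟩ := exists_shannon_le hσ hK hKC hf (sub_pos.2 hz')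
  rw [add_sub_cancel] at hβ
  have hle : ∀ n : ℕ, blockEntropy shift μ f n / n ≤ ((n + 1) * z + β / Real.log 2) / n := by
    intro n
    refine div_le_div_of_nonneg_right ?_ n.cast_nonneg
    rw [blockEntropy_eq_shannon_div, div_le_iff₀ hlog2]
    refine (hβ n).trans_eq ?_
    field_simp
  have hlim : Tendsto (fun n : ℕ => ((n + 1) * z + β / Real.log 2) / (n : ℝ)) atTop (nhds z) := by
    have h := (tendsto_const_div_atTop_nhds_zero_nat (z + β / Real.log 2)).const_add z
    rw [add_zero] at h
    refine h.congr' ?_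
    filter_upwards [eventually_gt_atTop 0] with n hn
    have : (n : ℝ) ≠ 0 := by positivity
    field_simp
    ring
  refine (limsup_le_limsup (Eventually.of_forall fun n =>
    EReal.coe_le_coe_iff.2 (hle n))).trans_eq ?_
  exact ((continuous_coe_real_ereal.tendsto z).comp hlim).limsup_eq

end EntropyBound

/-! ### Conclusion. -/

lemma logb_card_le_hMax {A : Type*} [Group A] [Finite A] {C : Subgroup A} (hC : C ≠ ⊤) :
    Real.logb 2 (Nat.card C) ≤ hMax A := by
  -- A finite group has finitely many subgroups, so the supremum is over a bounded set.
  refine le_csSup (Set.Finite.bddAbove ?_) ⟨C, hC, rfl⟩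
  refine (Set.finite_range fun C : Subgroup A => Real.logb 2 (Nat.card C)).subset ?_
  rintro r ⟨C, -, rfl⟩
  exact ⟨C, rfl⟩

end MultCA

theorem mainTheorem4 {A : Type*} [Group A] [Finite A] [MeasurableSpace A]
    [DiscreteMeasurableSpace A] (μ : Measure (ℕ → A)) [IsProbabilityMeasure μ]
    (hσ : MeasurePreserving (MultCA.shift (A := A)) μ μ)
    (hΦ : Ergodic (MultCA.multCA (A := A)) μ)
    (hent : ((MultCA.hMax A : ℝ) : EReal) < MultCA.entropy (MultCA.shift (A := A)) μ) :
    μ = MultCA.uniformMeasure A := by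
  have := Fintype.ofFinite A
  obtain ⟨p, hp⟩ := MultCA.exists_isTailDensity hσ
  obtain ⟨C, r, hconst, hmem⟩ := hp.exists_subgroup hσ hΦ
  have hC : C = ⊤ := by
    by_contra hne
    refine hent.not_ge ((MultCA.entropy_shift_le hσ (C := C) (K := fun s => {c | p s c ≠ 0})
      (fun s => (measurableSet_eq_fun (hp.measurable s) measurable_const).compl) hmem).trans ?_)
    exact EReal.coe_le_coe_iff.2 (MultCA.logb_card_le_hMax hne)
  refine hp.eq_uniformMeasure hσ (r := r) ?_
  filter_upwards [hconst, hp.sum_eq_one hσ] with c hc hsum x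
  obtain ⟨y, -, hy⟩ := Finset.exists_ne_zero_of_sum_ne_zero (hsum.trans_ne one_ne_zero)
  -- Since C = A, every `x` is a C-translate of the charged letter `y`, so all letters have the same
  -- conditional probability.
  rw [← hc y hy (x * y⁻¹) (hC ▸ Subgroup.mem_top _), inv_mul_cancel_right]
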